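/- Let $K$ be a field of characteristic $0$ (for instance $K=\mathbb{C}$, or a field of rational functions, in which $x$ below may be an indeterminate). The Euler polynomials $E_n(x)$ are defined by $$\frac{2e^{xt}}{e^t+1}=\sum_{n=0}^\infty E_n(x)\frac{t^n}{n!},$$ and for a sequence $(c_0,c_1,\ldots)$ the $n$th Hankel determinant is $H_n(c_k)=\det_{0\le i,j\le n}(c_{i+j})$. Let $q\ge 1$ and $0\le r<s$ be integers, let $x\in K$, and for $k\ge 0$ set $$e_k^{\pm}=E_k\Big(\frac{x+r}{q}\Big)\pm E_k\Big(\frac{x+s}{q}\Big).$$ Then for all integers $m\ge 0$ we have $H_{2m}(e_k^-)=0$, $$H_{2m+1}(e_k^-)=(-1)^{m+1}\Big(\frac{s-r}{q}\Big)^{2m+2}\prod_{\ell=1}^m\left(\frac{\ell^2}{4}\Big(\Big(\frac{s-r}{q}\Big)^2-(2\ell)^2\Big)\right)^{2(m+1-\ell)},$$ $$H_{2m}(e_k^+)=(-1)^m\,\frac{2^{2m+1}}{m!^2}\prod_{\ell=1}^m\left(\frac{\ell^2}{4}\Big(\Big(\frac{s-r}{q}\Big)^2-(2\ell-1)^2\Big)\right)^{2(m+1-\ell)},$$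 and $$H_{2m+1}(e_k^+)=\prod_{\ell=0}^m\frac{\ell!^4}{16^\ell}\left(\Big(\frac{s-r}{q}\Big)^2-(2\ell+1)^2\right)^{2(m-\ell)+1}.$$ In particular, all these determinants are independent of $x$. -/

import Mathlib

/-- The power series `2 / (e ^ z + 1)` over `ℚ`. -/
noncomputable def eulerBaseSeries : PowerSeries ℚ :=
  2 * (PowerSeries.exp ℚ + 1)⁻¹

/-- The series `2 e ^ (x z) / (e ^ z + 1)` as a power series in `z` whose coefficients are
polynomials in the indeterminate `x`. -/
noncomputable def eulerGenSeries : PowerSeries (Polynomial ℚ) :=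
  PowerSeries.map Polynomial.C eulerBaseSeries *
    PowerSeries.rescale Polynomial.X (PowerSeries.exp (Polynomial ℚ))

/-- The `n`-th Euler polynomial `E_n`: `n!` times the coefficient of `z ^ n` in
`2 e ^ (x z) / (e ^ z + 1)`, that is, `∑ E_n(x) z ^ n / n! = 2 e ^ (x z) / (e ^ z + 1)`. -/
noncomputable def eulerPolynomial (n : ℕ) : Polynomial ℚ :=
  (Nat.factorial n : Polynomial ℚ) * PowerSeries.coeff n eulerGenSeries

/-- The inverse of the power series `e ^ z + 1` is a genuine one, so that the generating series of
the Euler polynomials satisfies its defining equation. -/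
theorem eulerGenSeries_mul_exp_add_one :
    eulerGenSeries * (PowerSeries.exp (Polynomial ℚ) + 1) =
      2 * PowerSeries.rescale Polynomial.X (PowerSeries.exp (Polynomial ℚ)) := by
  have h0 : PowerSeries.constantCoeff (PowerSeries.exp ℚ + 1) ≠ 0 := by
    simp
  have h1 : eulerBaseSeries * (PowerSeries.exp ℚ + 1) = 2 := by
    rw [eulerBaseSeries, mul_assoc, PowerSeries.inv_mul_cancel _ h0, mul_one]
  have h2 := congrArg (PowerSeries.map (Polynomial.C : ℚ →+* Polynomial ℚ)) h1
  rw [map_mul, map_add, PowerSeries.map_exp, map_one, map_ofNat] at h2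
  rw [eulerGenSeries, mul_right_comm, h2]

/-- The value `E_n(y)` of the `n`-th Euler polynomial at an element `y` of a field of
characteristic zero. -/
noncomputable def eulerValue {K : Type*} [Field K] [CharZero K] (n : ℕ) (y : K) : K :=
  Polynomial.aeval y (eulerPolynomial n)

/-- The difference sequence `e_k^-(q,r,s;x) = E_k((x+r)/q) - E_k((x+s)/q)`. -/
noncomputable def eulerDiff {K : Type*} [Field K] [CharZero K] (q r s : ℤ) (x : K) (k : ℕ) : K :=
  eulerValue k ((x + r) / q) - eulerValue k ((x + s) / q)

/-- The sum sequence `e_k^+(q,r,s;x) = E_k((x+r)/q) + E_k((x+s)/q)`. -/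
noncomputable def eulerSum {K : Type*} [Field K] [CharZero K] (q r s : ℤ) (x : K) (k : ℕ) : K :=
  eulerValue k ((x + r) / q) + eulerValue k ((x + s) / q)

/-- The `n`-th Hankel determinant `H_n(c)`: the determinant of the `(n+1) × (n+1)` matrix
`(c_{i+j})`, `0 ≤ i, j ≤ n`. -/
def hankelDet {R : Type*} [CommRing R] (n : ℕ) (c : ℕ → R) : R :=
  (Matrix.of fun i j : Fin (n + 1) => c ((i : ℕ) + (j : ℕ))).det

/-!
Let `Λ_y` be the linear functional on polynomials with moments `Λ_y(X^k) = E_k(y)`. The generating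
function says exactly that `Λ_y(p(X + 1) + p(X)) = 2 p(y)`. Translating the variable leaves Hankel
determinants unchanged, so with `h = (y' - y) / 2` the functional `Λ_y ± Λ_{y'}` may be replaced by
a centred functional `L` satisfying

  `L(p(X + 1/2) + p(X - 1/2)) = 2 (p(-h) ± p(h))`   (`centeredFunctional_average`).

The averaging operator on the left maps `∏_{j<k} (X² - (j + 1/2)²)` to `2 ∏_{j<k} (X² - j²)` and
`X ∏_{j<k} (X² - (j + 1)²)` to `2 X ∏_{j<k} (X² - (j + 1/2)²)`. Hence `L` is known explicitly on a
basis: it vanishes on odd (for `+`) or even (for `-`) polynomials, and the rest of it becomes, in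
the variable `X²`, a functional `M` with

  `M(∏_{j<k} (X - (a + j)²)) = (-1)^k κ (a + b)_k (a + c)_k`,

the moments of a continuous dual Hahn weight. Testing `M` on products of the basis with parameter
`a` and the one with parameter `b` gives `± κ (a + b)_{i+j} (a + c)_i (b + c)_j`, which up to row
and column factors is the Hankel matrix of rising factorials, a Vandermonde determinant in
disguise (`det_hankelMatrix_dualHahn`). By parity the Hankel determinants of `L` split into those
of such functionals `M`, and the products are compared by induction on `m`.
-/

open Polynomial Finset

/-! ### Hankel determinants -/

/-- The `n × n` Hankel matrix `(c_{i+j})`; its size is `n`, one less than that of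
`hankelDet n c`. -/
def hankelMatrix {R : Type*} (n : ℕ) (c : ℕ → R) : Matrix (Fin n) (Fin n) R :=
  Matrix.of fun i j => c ((i : ℕ) + (j : ℕ))

/-- Evaluating a linear functional on products of two monic bases does not change the
determinant of its Hankel matrix of moments. -/
theorem det_functional_mul_eq_det_hankelMatrix {R : Type*} [CommRing R] (M : R[X] →ₗ[R] R)
    (P Q : ℕ → R[X]) (hP : ∀ i, (P i).Monic) (hPd : ∀ i, (P i).natDegree = i)
    (hQ : ∀ i, (Q i).Monic) (hQd : ∀ i, (Q i).natDegree = i) (n : ℕ) :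
    (Matrix.of fun i j : Fin n => M (P i * Q j)).det =
      (hankelMatrix n fun k => M (X ^ k)).det := by
  have key : (Matrix.of fun i j : Fin n => M (P i * Q j)) =
      (Matrix.of fun (i j : Fin n) => (P j).coeff i).transpose *
        hankelMatrix n (fun k => M (X ^ k)) *
        Matrix.of fun (i j : Fin n) => (Q j).coeff i := by
    ext i j
    have hp : P i = ∑ k : Fin n, C ((P i).coeff k) * X ^ (k : ℕ) := by
      rw [Fin.sum_univ_eq_sum_range (fun k => C ((P i).coeff k) * X ^ k)]
      exact as_sum_range_C_mul_X_pow' (P i) ((hPd i).trans_lt i.2)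
    have hq : Q j = ∑ k : Fin n, C ((Q j).coeff k) * X ^ (k : ℕ) := by
      rw [Fin.sum_univ_eq_sum_range (fun k => C ((Q j).coeff k) * X ^ k)]
      exact as_sum_range_C_mul_X_pow' (Q j) ((hQd j).trans_lt j.2)
    have hpq : P i * Q j = ∑ l : Fin n, ∑ k : Fin n,
        ((P i).coeff k * (Q j).coeff l) • (X : R[X]) ^ ((k : ℕ) + l) := by
      conv_lhs => rw [hp, hq, sum_mul_sum, sum_comm]
      refine sum_congr rfl fun l _ => sum_congr rfl fun k _ => ?_
      rw [smul_eq_C_mul, C_mul, pow_add]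
      ring
    simp only [Matrix.of_apply, hpq, map_sum, map_smul, smul_eq_mul, Matrix.mul_apply, sum_mul,
      Matrix.transpose_apply, hankelMatrix]
    refine sum_congr rfl fun l _ => sum_congr rfl fun k _ => ?_
    ring
  rw [key, Matrix.det_mul, Matrix.det_mul, Matrix.det_transpose,
    Matrix.det_matrixOfPolynomials (fun i : Fin n => P i) (fun i => hPd i) (fun i => hP i),
    Matrix.det_matrixOfPolynomials (fun i : Fin n => Q i) (fun i => hQd i) (fun i => hQ i),
    one_mul, mul_one]

/-- The indices below `a + b` listed by parity: the even ones, then the odd ones. -/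
noncomputable def paritySumEquiv (a b : ℕ) (h₁ : b ≤ a) (h₂ : a ≤ b + 1) :
    Fin a ⊕ Fin b ≃ Fin (a + b) :=
  Equiv.ofBijective
    (Sum.elim (fun i => ⟨2 * i, by have := i.2; omega⟩)
      (fun i => ⟨2 * i + 1, by have := i.2; omega⟩))
    ((Fintype.bijective_iff_injective_and_card _).2 ⟨by
      rintro (i | i) (j | j) h <;> simp [Fin.ext_iff] at h ⊢ <;> omega, by simp⟩)

/-- Listing the indices by parity puts a Hankel matrix in block form, with the even-indexed entries
in the diagonal blocks and the odd-indexed ones off the diagonal. -/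
theorem det_hankelMatrix_add {R : Type*} [CommRing R] (c : ℕ → R) (a b : ℕ) (h₁ : b ≤ a)
    (h₂ : a ≤ b + 1) :
    (hankelMatrix (a + b) c).det = (Matrix.fromBlocks
      (hankelMatrix a fun k => c (2 * k))
      (Matrix.of fun (i : Fin a) (j : Fin b) => c (2 * ((i : ℕ) + j) + 1))
      (Matrix.of fun (i : Fin b) (j : Fin a) => c (2 * ((i : ℕ) + j) + 1))
      (hankelMatrix b fun k => c (2 * k + 2))).det := by
  rw [← Matrix.det_submatrix_equiv_self (paritySumEquiv a b h₁ h₂)]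
  congr 1
  ext (i | i) (j | j) <;>
    simp only [hankelMatrix, paritySumEquiv, Matrix.submatrix_apply, Matrix.of_apply,
      Equiv.ofBijective_apply, Sum.elim_inl, Sum.elim_inr, Matrix.fromBlocks_apply₁₁,
      Matrix.fromBlocks_apply₁₂, Matrix.fromBlocks_apply₂₁, Matrix.fromBlocks_apply₂₂] <;>
    congr 1 <;> ring

theorem det_hankelMatrix_of_odd_eq_zero {R : Type*} [CommRing R] (c : ℕ → R)
    (hc : ∀ k, c (2 * k + 1) = 0) (a b : ℕ) (h₁ : b ≤ a) (h₂ : a ≤ b + 1) :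
    (hankelMatrix (a + b) c).det =
      (hankelMatrix a fun k => c (2 * k)).det * (hankelMatrix b fun k => c (2 * k + 2)).det := by
  rw [det_hankelMatrix_add c a b h₁ h₂]
  simp only [hc]
  exact Matrix.det_fromBlocks_zero₂₁ _ _ _

/-- The swap of the two blocks is written as a product of three shears and a sign change in the
first block. -/
theorem det_fromBlocks_zero_zero_self {R : Type*} [CommRing R] {n : ℕ}
    (B : Matrix (Fin n) (Fin n) R) :
    (Matrix.fromBlocks 0 B B 0).det = (-1) ^ n * B.det ^ 2 := by
  have h : Matrix.fromBlocks 0 B B 0 =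
      Matrix.fromBlocks B 0 0 B * (Matrix.fromBlocks 1 1 0 1 * Matrix.fromBlocks 1 0 (-1) 1 *
        Matrix.fromBlocks 1 1 0 1 * Matrix.fromBlocks (-1) 0 0 1) := by
    simp [Matrix.fromBlocks_multiply]
  rw [h]
  simp only [Matrix.det_mul, Matrix.det_fromBlocks_zero₂₁, Matrix.det_fromBlocks_zero₁₂,
    Matrix.det_one, Matrix.det_neg, Fintype.card_fin]
  ring

theorem det_hankelMatrix_of_even_eq_zero {R : Type*} [CommRing R] (c : ℕ → R)
    (hc : ∀ k, c (2 * k) = 0) (n : ℕ) :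
    (hankelMatrix (n + n) c).det =
      (-1) ^ n * (hankelMatrix n fun k => c (2 * k + 1)).det ^ 2 := by
  have hc' : ∀ k, c (2 * k + 2) = 0 := fun k => hc (k + 1)
  rw [det_hankelMatrix_add c n n le_rfl n.le_succ, ← det_fromBlocks_zero_zero_self]
  simp only [hc, hc']
  rfl

/-- Conjugation by `diag((-1)^i)` negates the matrix, which has odd size. -/
theorem det_hankelMatrix_odd_size_eq_zero {K : Type*} [Field K] [CharZero K] (c : ℕ → K)
    (hc : ∀ k, c (2 * k) = 0) (m : ℕ) : (hankelMatrix (2 * m + 1) c).det = 0 := by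
  have h : (hankelMatrix (2 * m + 1) c).det = -(hankelMatrix (2 * m + 1) c).det := by
    calc (hankelMatrix (2 * m + 1) c).det
        = (∏ i : Fin (2 * m + 1), (-1 : K) ^ (i : ℕ)) *
            ((∏ i : Fin (2 * m + 1), (-1 : K) ^ (i : ℕ)) * (hankelMatrix (2 * m + 1) c).det) := by
          rw [← mul_assoc, ← prod_mul_distrib]
          simp [← mul_pow]
      _ = (-hankelMatrix (2 * m + 1) c).det := by
          rw [← Matrix.det_mul_row, ← Matrix.det_mul_column]
          congr 1
          ext i j
          simp only [hankelMatrix, Matrix.of_apply, Matrix.neg_apply]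
          rw [← mul_assoc, ← pow_add]
          rcases Nat.even_or_odd' ((i : ℕ) + j) with ⟨k, hk | hk⟩
          · rw [hk, hc]; simp
          · rw [hk, pow_succ, pow_mul]; simp
      _ = _ := by
          rw [Matrix.det_neg, Fintype.card_fin, pow_succ, pow_mul]; simp
  exact self_eq_neg.1 h

/-! ### A determinant of continuous dual Hahn type -/

/-- The rising factorial `z (z + 1) ⋯ (z + k - 1)`. -/
def rising {R : Type*} [CommRing R] (z : R) (k : ℕ) : R := ∏ j ∈ range k, (z + j)

theorem rising_succ {R : Type*} [CommRing R] (z : R) (k : ℕ) :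
    rising z (k + 1) = rising z k * (z + k) := prod_range_succ _ _

theorem rising_succ' {R : Type*} [CommRing R] (z : R) (k : ℕ) :
    rising z (k + 1) = z * rising (z + 1) k := by
  rw [rising, prod_range_succ', rising, mul_comm]
  simp only [Nat.cast_zero, add_zero, Nat.cast_succ]
  congr 1
  exact prod_congr rfl fun j _ => by ring

theorem rising_one {R : Type*} [CommRing R] (i : ℕ) : rising (1 : R) i = i.factorial := by
  induction i with
  | zero => simp [rising]
  | succ i ih => rw [rising_succ, ih, Nat.factorial_succ]; push_cast; ring

theorem rising_add {R : Type*} [CommRing R] (z : R) (i j : ℕ) :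
    rising z (i + j) = rising z i * rising (z + i) j := by
  simp only [rising, prod_range_add, Nat.cast_add, add_assoc]

/-- The factor `rising z i` comes out of row `i`, and what remains is a monic polynomial of degree
`j` evaluated at `i`, so a Vandermonde determinant. -/
theorem det_rising_add {K : Type*} [CommRing K] [Nontrivial K] (z : K) (n : ℕ) :
    (hankelMatrix n (rising z)).det = ∏ i ∈ range n, rising z i * (i.factorial : K) := by
  rcases n with _ | n
  · simp
  have hmonic : ∀ j : ℕ, (∏ l ∈ range j, (X + C (z + l))).Monic := fun j =>
    monic_prod_of_monic _ _ fun l _ => monic_X_add_C _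
  have hdeg : ∀ j : ℕ, (∏ l ∈ range j, (X + C (z + l))).natDegree = j := fun j => by
    rw [natDegree_prod_of_monic _ _ fun l _ => monic_X_add_C _]
    simp only [natDegree_X_add_C, sum_const, card_range, smul_eq_mul, mul_one]
  have h : hankelMatrix (n + 1) (rising z) = Matrix.of fun i j : Fin (n + 1) =>
      rising z i * (Matrix.of fun i j : Fin (n + 1) =>
        (∏ l ∈ range (j : ℕ), (X + C (z + l))).eval ((i : ℕ) : K)) i j := by
    ext i j
    simp only [hankelMatrix, Matrix.of_apply, rising_add, eval_prod, eval_add, eval_X, eval_C]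
    congr 1
    exact prod_congr rfl fun l _ => by ring
  rw [h, Matrix.det_mul_column, ← Matrix.det_eval_matrixOfPolynomials_eq_det_vandermonde
    (fun i : Fin (n + 1) => ((i : ℕ) : K)) (fun j => ∏ l ∈ range (j : ℕ), (X + C (z + l)))
    (fun j => hdeg j) (fun j => hmonic j), Matrix.det_vandermonde_id_eq_superFactorial,
    ← Nat.prod_range_succ_factorial, prod_mul_distrib, Nat.cast_prod,
    Fin.prod_univ_eq_prod_range (rising z)]

/-- The monic polynomial `∏_{j < k} (X - (a + j)²)`. -/
noncomputable def dualHahnBasis {R : Type*} [CommRing R] (a : R) (k : ℕ) : R[X] :=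
  ∏ j ∈ range k, (X - C ((a + j) ^ 2))

theorem dualHahnBasis_succ {R : Type*} [CommRing R] (a : R) (k : ℕ) :
    dualHahnBasis a (k + 1) = dualHahnBasis a k * (X - C ((a + k) ^ 2)) := prod_range_succ _ _

theorem monic_dualHahnBasis {R : Type*} [CommRing R] (a : R) (k : ℕ) :
    (dualHahnBasis a k).Monic := monic_prod_of_monic _ _ fun _ _ => monic_X_sub_C _

theorem natDegree_dualHahnBasis {R : Type*} [CommRing R] [Nontrivial R] (a : R) (k : ℕ) :
    (dualHahnBasis a k).natDegree = k := by
  rw [dualHahnBasis, natDegree_prod_of_monic _ _ fun l _ => monic_X_sub_C _]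
  simp only [natDegree_X_sub_C, sum_const, card_range, smul_eq_mul, mul_one]

/-- A functional vanishing on the monic basis `dualHahnBasis a` vanishes. The induction multiplies
by `X = (X - (a + k)²) + (a + k)²`, which stays in the span of two consecutive basis elements. -/
theorem functional_X_pow_eq_zero {R : Type*} [CommRing R] (M : R[X] →ₗ[R] R) (a : R)
    (hM : ∀ k, M (dualHahnBasis a k) = 0) (n : ℕ) : M (X ^ n) = 0 := by
  have h : ∀ n k, M (dualHahnBasis a k * X ^ n) = 0 := by
    intro n
    induction n with
    | zero => simpa using hM
    | succ n ih =>
      intro k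
      have e : dualHahnBasis a k * X ^ (n + 1) =
          dualHahnBasis a (k + 1) * X ^ n + ((a + k) ^ 2) • (dualHahnBasis a k * X ^ n) := by
        rw [dualHahnBasis_succ, smul_eq_C_mul]; ring
      rw [e, map_add, map_smul, ih, ih, smul_zero, add_zero]
  simpa [dualHahnBasis] using h n 0

/-- The values on mixed products, by induction on `j` from
`X - (b + j)² = (X - (a + i)²) + ((a + i)² - (b + j)²)`. -/
theorem functional_dualHahnBasis_mul {R : Type*} [CommRing R] (M : R[X] →ₗ[R] R) (a b c κ : R)
    (hM : ∀ k, M (dualHahnBasis a k) = (-1) ^ k * κ * rising (a + b) k * rising (a + c) k)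
    (i j : ℕ) :
    M (dualHahnBasis a i * dualHahnBasis b j) =
      (-1) ^ (i + j) * κ * rising (a + b) (i + j) * rising (a + c) i * rising (b + c) j := by
  induction j generalizing i with
  | zero => simpa [dualHahnBasis, rising] using hM i
  | succ j ih =>
    have e : dualHahnBasis a i * dualHahnBasis b (j + 1) =
        dualHahnBasis a (i + 1) * dualHahnBasis b j +
          ((a + i) ^ 2 - (b + j) ^ 2) • (dualHahnBasis a i * dualHahnBasis b j) := by
      rw [dualHahnBasis_succ, dualHahnBasis_succ, smul_eq_C_mul, C_sub]; ring
    rw [e, map_add, map_smul, ih, ih, smul_eq_mul, show i + 1 + j = i + j + 1 by ring,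
      show i + (j + 1) = i + j + 1 by ring, rising_succ, rising_succ, rising_succ]
    push_cast
    ring

/-- A functional with the moments of the continuous dual Hahn weight, tested against the bases
with parameters `a` and `b`, has the Hankel determinant of rising factorials up to scaling rows
and columns. -/
theorem det_hankelMatrix_dualHahn {R : Type*} [CommRing R] [Nontrivial R] (M : R[X] →ₗ[R] R)
    (a b c κ : R)
    (hM : ∀ k, M (dualHahnBasis a k) = (-1) ^ k * κ * rising (a + b) k * rising (a + c) k)
    (n : ℕ) :
    (hankelMatrix n fun k => M (X ^ k)).det =
      ∏ i ∈ range n, κ * (rising (a + b) i * rising (a + c) i * rising (b + c) i *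
        (i.factorial : R)) := by
  rw [← det_functional_mul_eq_det_hankelMatrix M (dualHahnBasis a) (dualHahnBasis b)
    (monic_dualHahnBasis a) (natDegree_dualHahnBasis a) (monic_dualHahnBasis b)
    (natDegree_dualHahnBasis b)]
  have h : (Matrix.of fun i j : Fin n => M (dualHahnBasis a i * dualHahnBasis b j)) =
      Matrix.of fun i j : Fin n => ((-1) ^ (i : ℕ) * κ * rising (a + c) i) *
        (Matrix.of fun i j : Fin n => ((-1) ^ (j : ℕ) * rising (b + c) j) *
          hankelMatrix n (rising (a + b)) i j) i j := by
    ext i j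
    simp only [Matrix.of_apply, hankelMatrix, functional_dualHahnBasis_mul M a b c κ hM]
    ring
  rw [h, Matrix.det_mul_column, Matrix.det_mul_row, det_rising_add,
    Fin.prod_univ_eq_prod_range (fun i => (-1) ^ i * κ * rising (a + c) i),
    Fin.prod_univ_eq_prod_range (fun i => (-1) ^ i * rising (b + c) i), ← prod_mul_distrib,
    ← prod_mul_distrib]
  refine prod_congr rfl fun i _ => ?_
  have h1 : (-1 : R) ^ i * (-1) ^ i = 1 := by rw [← mul_pow]; simp
  linear_combination (κ * rising (a + c) i * rising (b + c) i * rising (a + b) i *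
    (i.factorial : R)) * h1

/-- The functional `f ↦ L(g · f(X²))`. -/
noncomputable def squareFunctional {R : Type*} [CommRing R] (L : R[X] →ₗ[R] R) (g : R[X]) :
    R[X] →ₗ[R] R :=
  L ∘ₗ LinearMap.mulLeft R g ∘ₗ (aeval (X ^ 2 : R[X])).toLinearMap

theorem squareFunctional_apply {R : Type*} [CommRing R] (L : R[X] →ₗ[R] R) (g f : R[X]) :
    squareFunctional L g f = L (g * f.comp (X ^ 2)) := rfl

theorem squareFunctional_X_pow {R : Type*} [CommRing R] (L : R[X] →ₗ[R] R) (l k : ℕ) :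
    squareFunctional L (X ^ l) (X ^ k) = L (X ^ (2 * k + l)) := by
  rw [squareFunctional_apply, X_pow_comp, ← pow_mul, ← pow_add, add_comm]

theorem dualHahnBasis_comp_comp_sq {R : Type*} [CommRing R] (a : R) (k : ℕ) (g : R[X]) :
    ((dualHahnBasis a k).comp (X ^ 2)).comp g =
      (-1) ^ k * (rising (C a + g) k * rising (C a - g) k) := by
  induction k with
  | zero => simp [dualHahnBasis, rising]
  | succ k ih =>
    rw [dualHahnBasis_succ, mul_comp, mul_comp, ih, rising_succ, rising_succ]
    simp only [sub_comp, X_comp, C_pow, C_add, map_natCast, pow_comp, add_comp, C_comp, natCast_comp]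
    ring

theorem eval_dualHahnBasis_sq {R : Type*} [CommRing R] (a h : R) (k : ℕ) :
    ((dualHahnBasis a k).comp (X ^ 2)).eval h =
      (-1) ^ k * (rising (a + h) k * rising (a - h) k) := by
  induction k with
  | zero => simp [dualHahnBasis, rising]
  | succ k ih =>
    rw [dualHahnBasis_succ, mul_comp, eval_mul, ih, rising_succ, rising_succ]
    simp only [sub_comp, X_comp, C_comp, eval_sub, eval_pow, eval_X, eval_C]
    ring

/-! ### Euler polynomials as moments -/

/-- The relation `E_n(X + 1) + E_n(X) = 2 X ^ n`, with the binomial sum in place of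
`E_n(X + 1)`. -/
theorem sum_choose_mul_eulerPolynomial_add (n : ℕ) :
    ∑ k ∈ range (n + 1), (n.choose k : ℚ[X]) * eulerPolynomial k + eulerPolynomial n =
      2 * X ^ n := by
  have h := congrArg (fun f => (n.factorial : ℚ[X]) * PowerSeries.coeff n f)
    eulerGenSeries_mul_exp_add_one
  have h2 : (2 : PowerSeries ℚ[X]) = PowerSeries.C (2 : ℚ[X]) := (map_ofNat _ 2).symm
  simp only [mul_add, mul_one, map_add, h2, PowerSeries.coeff_C_mul,
    PowerSeries.coeff_rescale, PowerSeries.coeff_exp] at h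
  rw [PowerSeries.coeff_mul] at h
  simp only [PowerSeries.coeff_exp] at h
  rw [Finset.Nat.sum_antidiagonal_eq_sum_range_succ (fun i j =>
    PowerSeries.coeff i eulerGenSeries * algebraMap ℚ ℚ[X] (1 / (j.factorial : ℚ)))] at h
  have hn : (n.factorial : ℚ[X]) * algebraMap ℚ ℚ[X] (1 / (n.factorial : ℚ)) = 1 := by
    rw [← map_natCast (algebraMap ℚ ℚ[X]), ← map_mul, mul_one_div_cancel, map_one]
    exact_mod_cast n.factorial_ne_zero
  have hr : (n.factorial : ℚ[X]) * (2 * (X ^ n * algebraMap ℚ ℚ[X] (1 / (n.factorial : ℚ)))) =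
      2 * X ^ n := by
    linear_combination 2 * X ^ n * hn
  rw [hr] at h
  rw [← h, mul_sum, eulerPolynomial]
  congr 1
  refine sum_congr rfl fun k hk => ?_
  have hk' : k ≤ n := Nat.lt_succ_iff.1 (mem_range.1 hk)
  have hc : (n.factorial : ℚ[X]) * algebraMap ℚ ℚ[X] (1 / ((n - k).factorial : ℚ)) =
      n.choose k * k.factorial := by
    rw [← map_natCast (algebraMap ℚ ℚ[X]), ← map_natCast (algebraMap ℚ ℚ[X]) (n.choose k),
      ← map_natCast (algebraMap ℚ ℚ[X]) k.factorial, ← map_mul, ← map_mul]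
    congr 1
    have h0 : ((n - k).factorial : ℚ) ≠ 0 := by exact_mod_cast (n - k).factorial_ne_zero
    field_simp
    rw [← Nat.choose_mul_factorial_mul_factorial hk']
    push_cast
    ring
  rw [eulerPolynomial]
  linear_combination -(PowerSeries.coeff k eulerGenSeries) * hc

section Euler

variable {K : Type*} [Field K] [CharZero K]

/-- The linear functional with moments `E_k(y)`, the `Λ_y` of the introduction. -/
noncomputable def eulerFunctional (y : K) : K[X] →ₗ[K] K :=
  lsum fun k => eulerValue k y • LinearMap.id

theorem eulerFunctional_X_pow (y : K) (k : ℕ) : eulerFunctional y (X ^ k) = eulerValue k y := by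
  simp [eulerFunctional, lsum_apply, ← monomial_one_right_eq_X_pow, sum_monomial_index]

theorem eulerFunctional_comp_add (y : K) (p : K[X]) :
    eulerFunctional y (p.comp (X + 1) + p) = 2 * p.eval y := by
  induction p using Polynomial.induction_on' with
  | add p q hp hq =>
    rw [add_comp, add_add_add_comm, map_add, hp, hq, eval_add, mul_add]
  | monomial n a =>
    have h := congrArg (aeval y) (sum_choose_mul_eulerPolynomial_add n)
    simp only [map_add, map_sum, map_mul, map_natCast, map_pow, aeval_X, map_ofNat] at h
    have e : (monomial n a).comp (X + 1) + monomial n a =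
        a • ((∑ k ∈ range (n + 1), (n.choose k : K) • X ^ k) + X ^ n : K[X]) := by
      rw [← C_mul_X_pow_eq_monomial, mul_comp, C_comp, X_pow_comp, add_pow, ← smul_eq_C_mul,
        ← smul_eq_C_mul, ← smul_add]
      congr 2
      refine sum_congr rfl fun k _ => ?_
      rw [one_pow, mul_one, mul_comm, smul_eq_C_mul, map_natCast]
    rw [e, map_smul, map_add, map_sum, eval_monomial]
    simp only [map_smul, eulerFunctional_X_pow, smul_eq_mul, eulerValue]
    rw [h]
    ring

/-- The functional `p ↦ Λ_y(p) + ε Λ_{y'}(p)`, where `Λ_y` has moments `E_k(y)`, precomposed with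
the translation that makes it symmetric about `0`. -/
noncomputable def centeredFunctional (ε y y' : K) : K[X] →ₗ[K] K :=
  (eulerFunctional y + ε • eulerFunctional y') ∘ₗ
    (aeval (X - C ((y + y' - 1) / 2) : K[X])).toLinearMap

theorem centeredFunctional_apply (ε y y' : K) (p : K[X]) : centeredFunctional ε y y' p =
    (eulerFunctional y + ε • eulerFunctional y') (p.comp (X - C ((y + y' - 1) / 2))) := rfl

theorem centeredFunctional_average (ε y y' : K) (p : K[X]) :
    centeredFunctional ε y y' (p.comp (X + C (1 / 2)) + p.comp (X - C (1 / 2))) =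
      2 * (p.eval (-((y' - y) / 2)) + ε * p.eval ((y' - y) / 2)) := by
  set q := p.comp (X - C ((y + y') / 2)) with hq
  have e : (p.comp (X + C (1 / 2)) + p.comp (X - C (1 / 2))).comp
      (X - C ((y + y' - 1) / 2)) = q.comp (X + 1) + q := by
    rw [hq, add_comp, comp_assoc, comp_assoc, comp_assoc]
    congr 2
    · have hC : C ((y + y') / 2) + C (1 / 2 : K) = C ((y + y' - 1) / 2) + 1 := by
        rw [← C_1, ← C_add, ← C_add]
        congr 1; ring
      simp only [add_comp, X_comp, C_comp, sub_comp]
      linear_combination hC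
    · have hC : C ((y + y') / 2) = C ((y + y' - 1) / 2) + C (1 / 2 : K) := by
        rw [← C_add]
        congr 1; ring
      simp only [X_comp, C_comp, sub_comp]
      linear_combination hC
  rw [centeredFunctional_apply, e, LinearMap.add_apply, LinearMap.smul_apply,
    eulerFunctional_comp_add, eulerFunctional_comp_add, hq, eval_comp, eval_comp, smul_eq_mul]
  simp only [eval_sub, eval_X, eval_C]
  rw [show y - (y + y') / 2 = -((y' - y) / 2) by ring,
    show y' - (y + y') / 2 = (y' - y) / 2 by ring]
  ring

/-- Hankel determinants are invariant under translation of the variable. -/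
theorem hankelDet_eq_det_centeredFunctional (ε y y' : K) (n : ℕ) :
    hankelDet n (fun k => eulerValue k y + ε * eulerValue k y') =
      (hankelMatrix (n + 1) fun k => centeredFunctional ε y y' (X ^ k)).det := by
  have h := det_functional_mul_eq_det_hankelMatrix (eulerFunctional y + ε • eulerFunctional y')
    (fun i => (X - C ((y + y' - 1) / 2)) ^ i) (fun i => (X - C ((y + y' - 1) / 2)) ^ i)
    (fun i => (monic_X_sub_C _).pow i)
    (fun i => by rw [natDegree_pow, natDegree_X_sub_C, mul_one])
    (fun i => (monic_X_sub_C _).pow i)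
    (fun i => by rw [natDegree_pow, natDegree_X_sub_C, mul_one]) (n + 1)
  have e1 : hankelDet n (fun k => eulerValue k y + ε * eulerValue k y') =
      (hankelMatrix (n + 1)
        fun k => (eulerFunctional y + ε • eulerFunctional y') (X ^ k)).det := by
    simp only [LinearMap.add_apply, LinearMap.smul_apply, eulerFunctional_X_pow, smul_eq_mul]
    rfl
  rw [e1, ← h]
  congr 1
  ext i j
  simp only [hankelMatrix, Matrix.of_apply, centeredFunctional_apply, pow_add, mul_comp, X_pow_comp]

/-! ### Values of the symmetric functionals -/

/-- The averaging operator lowers the parameter of `dualHahnBasis` from `1/2` to `0`, because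
`(X + 1)_k (-X)_k + (X)_k (1 - X)_k = 2 (X)_k (-X)_k`. -/
theorem average_dualHahnBasis_half (k : ℕ) :
    ((dualHahnBasis (1 / 2 : K) k).comp (X ^ 2)).comp (X + C (1 / 2)) +
      ((dualHahnBasis (1 / 2 : K) k).comp (X ^ 2)).comp (X - C (1 / 2)) =
      (2 : K) • (dualHahnBasis (0 : K) k).comp (X ^ 2) := by
  have h0 : (dualHahnBasis (0 : K) k).comp (X ^ 2) =
      (-1) ^ k * (rising (X : K[X]) k * rising (-X : K[X]) k) := by
    simpa using dualHahnBasis_comp_comp_sq (0 : K) k X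
  have hC : C (1 / 2 : K) + C (1 / 2) = 1 := by rw [← C_add]; norm_num
  rw [dualHahnBasis_comp_comp_sq, dualHahnBasis_comp_comp_sq, h0, smul_eq_C_mul,
    show C (1 / 2 : K) + (X + C (1 / 2)) = X + 1 by linear_combination hC,
    show C (1 / 2 : K) - (X + C (1 / 2)) = -X by ring,
    show C (1 / 2 : K) + (X - C (1 / 2)) = X by ring,
    show C (1 / 2 : K) - (X - C (1 / 2)) = -X + 1 by linear_combination hC, C_ofNat]
  cases k with
  | zero => simp [rising]; norm_num
  | succ k =>
    rw [rising_succ (X + 1), rising_succ' (-X), rising_succ' X, rising_succ (-X + 1)]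
    ring

/-- With `z = 1/2 + X` and `w = 1/2 - X`, both averages are multiples of `(z)_k (w)_k`, by the
factors `z + k` and `-(w + k)`, whose sum is `2 X`. -/
theorem average_X_mul_dualHahnBasis_one (k : ℕ) :
    (X * (dualHahnBasis (1 : K) k).comp (X ^ 2)).comp (X + C (1 / 2)) +
      (X * (dualHahnBasis (1 : K) k).comp (X ^ 2)).comp (X - C (1 / 2)) =
      (2 : K) • (X * (dualHahnBasis (1 / 2 : K) k).comp (X ^ 2)) := by
  have h0 : (dualHahnBasis (1 / 2 : K) k).comp (X ^ 2) =
      (-1) ^ k * (rising (C (1 / 2) + X : K[X]) k * rising (C (1 / 2) - X : K[X]) k) := by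
    simpa only [comp_X] using dualHahnBasis_comp_comp_sq (1 / 2 : K) k X
  have hC : C (1 / 2 : K) + C (1 / 2) = 1 := by rw [← C_add]; norm_num
  rw [mul_comp, mul_comp, X_comp, X_comp, dualHahnBasis_comp_comp_sq, dualHahnBasis_comp_comp_sq,
    h0, smul_eq_C_mul, C_1, C_ofNat,
    show 1 + (X + C (1 / 2 : K)) = (C (1 / 2) + X) + 1 by ring,
    show 1 - (X + C (1 / 2 : K)) = C (1 / 2) - X by linear_combination -hC,
    show 1 + (X - C (1 / 2 : K)) = C (1 / 2) + X by linear_combination -hC,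
    show 1 - (X - C (1 / 2 : K)) = (C (1 / 2) - X) + 1 by ring]
  have h1 := (rising_succ' (C (1 / 2 : K) + X) k).symm.trans (rising_succ _ _)
  have h2 := (rising_succ' (C (1 / 2 : K) - X) k).symm.trans (rising_succ _ _)
  linear_combination (-1) ^ k * rising (C (1 / 2 : K) - X) k * h1 -
    (-1) ^ k * rising (C (1 / 2 : K) + X) k * h2

variable {L : K[X] →ₗ[K] K} {ε h : K}

theorem functional_dualHahnBasis_zero
    (hL : ∀ p : K[X], L (p.comp (X + C (1 / 2)) + p.comp (X - C (1 / 2))) =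
      2 * (p.eval (-h) + ε * p.eval h)) (k : ℕ) :
    L ((dualHahnBasis (0 : K) k).comp (X ^ 2)) =
      (1 + ε) * ((-1) ^ k * (rising (1 / 2 + h) k * rising (1 / 2 - h) k)) := by
  have e := hL ((dualHahnBasis (1 / 2 : K) k).comp (X ^ 2))
  rw [average_dualHahnBasis_half, map_smul, smul_eq_mul, eval_dualHahnBasis_sq,
    eval_dualHahnBasis_sq, ← sub_eq_add_neg, sub_neg_eq_add] at e
  linear_combination e / 2

theorem functional_X_mul_dualHahnBasis_half
    (hL : ∀ p : K[X], L (p.comp (X + C (1 / 2)) + p.comp (X - C (1 / 2))) =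
      2 * (p.eval (-h) + ε * p.eval h)) (k : ℕ) :
    L (X * (dualHahnBasis (1 / 2 : K) k).comp (X ^ 2)) =
      (ε - 1) * h * ((-1) ^ k * (rising (1 + h) k * rising (1 - h) k)) := by
  have e := hL (X * (dualHahnBasis (1 : K) k).comp (X ^ 2))
  rw [average_X_mul_dualHahnBasis_one, map_smul, smul_eq_mul, eval_mul, eval_mul, eval_X, eval_X,
    eval_dualHahnBasis_sq, eval_dualHahnBasis_sq, ← sub_eq_add_neg, sub_neg_eq_add] at e
  linear_combination e / 2

theorem functional_X_pow_odd_eq_zero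
    (hL : ∀ p : K[X], L (p.comp (X + C (1 / 2)) + p.comp (X - C (1 / 2))) =
      2 * (p.eval (-h) + 1 * p.eval h)) (k : ℕ) : L (X ^ (2 * k + 1)) = 0 := by
  rw [← squareFunctional_X_pow]
  refine functional_X_pow_eq_zero _ (1 / 2) (fun j => ?_) k
  rw [squareFunctional_apply, pow_one, functional_X_mul_dualHahnBasis_half hL]
  ring

theorem functional_X_pow_even_eq_zero
    (hL : ∀ p : K[X], L (p.comp (X + C (1 / 2)) + p.comp (X - C (1 / 2))) =
      2 * (p.eval (-h) + (-1) * p.eval h)) (k : ℕ) : L (X ^ (2 * k)) = 0 := by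
  have e := squareFunctional_X_pow L 0 k
  rw [add_zero] at e
  rw [← e]
  refine functional_X_pow_eq_zero _ 0 (fun j => ?_) k
  rw [squareFunctional_apply, pow_zero, one_mul, functional_dualHahnBasis_zero hL]
  ring

/-- The parameters are `a = 0`, `b = 1/2 + h`, `c = 1/2 - h`. -/
theorem det_even_moments
    (hL : ∀ p : K[X], L (p.comp (X + C (1 / 2)) + p.comp (X - C (1 / 2))) =
      2 * (p.eval (-h) + 1 * p.eval h)) (n : ℕ) :
    (hankelMatrix n fun k => L (X ^ (2 * k))).det =
      ∏ i ∈ range n,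
        2 * (rising (1 / 2 + h) i * rising (1 / 2 - h) i * (i.factorial : K) ^ 2) := by
  have e := det_hankelMatrix_dualHahn (squareFunctional L (X ^ 0)) 0 (1 / 2 + h) (1 / 2 - h) 2
    (fun k => by
      rw [squareFunctional_apply, pow_zero, one_mul, functional_dualHahnBasis_zero hL, zero_add,
        zero_add]
      ring) n
  simp only [squareFunctional_X_pow, add_zero, zero_add] at e
  rw [e]
  refine prod_congr rfl fun i _ => ?_
  rw [show (1 / 2 + h + (1 / 2 - h) : K) = 1 by ring, rising_one]
  ring

/-- Since `X² ∏_{j<k} (X² - (1 + j)²) = ∏_{j<k+1} (X² - j²)`, the extra factor `X²` only raises `a`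
from `0` to `1`, with `b = 1/2 + h` and `c = 1/2 - h` as for `det_even_moments`. -/
theorem det_even_moments_shift
    (hL : ∀ p : K[X], L (p.comp (X + C (1 / 2)) + p.comp (X - C (1 / 2))) =
      2 * (p.eval (-h) + 1 * p.eval h)) (n : ℕ) :
    (hankelMatrix n fun k => L (X ^ (2 * k + 2))).det =
      ∏ i ∈ range n, -2 * (rising (1 / 2 + h) (i + 1) * rising (1 / 2 - h) (i + 1) *
        (i.factorial : K) ^ 2) := by
  have hX (k : ℕ) : X ^ 2 * (dualHahnBasis (1 : K) k).comp (X ^ 2) =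
      (dualHahnBasis (0 : K) (k + 1)).comp (X ^ 2) := by
    rw [dualHahnBasis, dualHahnBasis, prod_range_succ', mul_comp, mul_comm]
    congr 1
    · congr 1
      refine prod_congr rfl fun j _ => ?_
      congr 2
      push_cast; ring
    · simp
  have e := det_hankelMatrix_dualHahn (squareFunctional L (X ^ 2)) 1 (1 / 2 + h) (1 / 2 - h)
    (-2 * ((1 / 2 + h) * (1 / 2 - h)))
    (fun k => by
      rw [squareFunctional_apply, hX, functional_dualHahnBasis_zero hL, rising_succ', rising_succ',
        add_comm 1 (1 / 2 + h), add_comm 1 (1 / 2 - h)]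
      ring) n
  simp only [squareFunctional_X_pow] at e
  rw [e]
  refine prod_congr rfl fun i _ => ?_
  rw [show (1 / 2 + h + (1 / 2 - h) : K) = 1 by ring, rising_one, rising_succ', rising_succ',
    add_comm 1 (1 / 2 + h), add_comm 1 (1 / 2 - h)]
  ring

/-- The parameters are `a = 1/2`, `b = 1/2 + h`, `c = 1/2 - h`. -/
theorem det_odd_moments
    (hL : ∀ p : K[X], L (p.comp (X + C (1 / 2)) + p.comp (X - C (1 / 2))) =
      2 * (p.eval (-h) + (-1) * p.eval h)) (n : ℕ) :
    (hankelMatrix n fun k => L (X ^ (2 * k + 1))).det =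
      ∏ i ∈ range n, -2 * h * (rising (1 + h) i * rising (1 - h) i * (i.factorial : K) ^ 2) := by
  have e := det_hankelMatrix_dualHahn (squareFunctional L (X ^ 1)) (1 / 2) (1 / 2 + h) (1 / 2 - h)
    (-2 * h)
    (fun k => by
      rw [squareFunctional_apply, pow_one, functional_X_mul_dualHahnBasis_half hL,
        show (1 / 2 + (1 / 2 + h) : K) = 1 + h by ring,
        show (1 / 2 + (1 / 2 - h) : K) = 1 - h by ring]
      ring) n
  simp only [squareFunctional_X_pow] at e
  rw [e]
  refine prod_congr rfl fun i _ => ?_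
  rw [show (1 / 2 + h + (1 / 2 - h) : K) = 1 by ring, rising_one,
    show (1 / 2 + (1 / 2 + h) : K) = 1 + h by ring,
    show (1 / 2 + (1 / 2 - h) : K) = 1 - h by ring]
  ring

end Euler

/-! ### Evaluating the products -/

/-- Passing from `m` to `m + 1` raises every exponent by two. -/
theorem prod_Icc_pow_succ {R : Type*} [CommRing R] (f : ℕ → R) (m : ℕ) :
    ∏ ℓ ∈ Icc 1 (m + 1), f ℓ ^ (2 * (m + 1 + 1 - ℓ)) =
      (∏ ℓ ∈ Icc 1 m, f ℓ ^ (2 * (m + 1 - ℓ))) * (∏ ℓ ∈ Icc 1 (m + 1), f ℓ) ^ 2 := by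
  rw [prod_Icc_succ_top (by omega), prod_Icc_succ_top (by omega), mul_pow, ← mul_assoc,
    ← prod_pow, ← prod_mul_distrib, show 2 * (m + 1 + 1 - (m + 1)) = 2 by omega]
  congr 1
  refine prod_congr rfl fun ℓ hl => ?_
  rw [← pow_add]
  congr 1
  have := (mem_Icc.1 hl).2
  omega

section Products

variable {K : Type*} [Field K] [CharZero K]

theorem prod_Icc_odd_factor (h : K) (n : ℕ) :
    ∏ ℓ ∈ Icc 1 n, ((ℓ : K) ^ 2 / 4 * ((2 * h) ^ 2 - (2 * (ℓ : K) - 1) ^ 2)) =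
      (-1) ^ n * (n.factorial : K) ^ 2 * (rising (1 / 2 + h) n * rising (1 / 2 - h) n) := by
  induction n with
  | zero => simp [rising]
  | succ n ih =>
    rw [prod_Icc_succ_top (by omega), ih, rising_succ, rising_succ, Nat.factorial_succ]
    push_cast
    ring

theorem prod_Icc_even_factor (h : K) (n : ℕ) :
    ∏ ℓ ∈ Icc 1 n, ((ℓ : K) ^ 2 / 4 * ((2 * h) ^ 2 - (2 * (ℓ : K)) ^ 2)) =
      (-1) ^ n * (n.factorial : K) ^ 2 * (rising (1 + h) n * rising (1 - h) n) := by
  induction n with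
  | zero => simp [rising]
  | succ n ih =>
    rw [prod_Icc_succ_top (by omega), ih, rising_succ, rising_succ, Nat.factorial_succ]
    push_cast
    ring

theorem prod_range_odd_factor (h : K) (n : ℕ) :
    ∏ ℓ ∈ range n, ((2 * h) ^ 2 - (2 * (ℓ : K) + 1) ^ 2) =
      (-4) ^ n * (rising (1 / 2 + h) n * rising (1 / 2 - h) n) := by
  induction n with
  | zero => simp [rising]
  | succ n ih =>
    rw [prod_range_succ, ih, rising_succ, rising_succ]
    ring

theorem difference_product (h : K) (m : ℕ) :
    (-1) ^ (m + 1) * (∏ i ∈ range (m + 1),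
        -2 * h * (rising (1 + h) i * rising (1 - h) i * (i.factorial : K) ^ 2)) ^ 2 =
      (-1) ^ (m + 1) * (2 * h) ^ (2 * m + 2) * ∏ ℓ ∈ Icc 1 m,
        ((ℓ : K) ^ 2 / 4 * ((2 * h) ^ 2 - (2 * (ℓ : K)) ^ 2)) ^ (2 * (m + 1 - ℓ)) := by
  induction m with
  | zero => simp [rising]
  | succ m ih =>
    rw [prod_Icc_pow_succ (fun ℓ => (ℓ : K) ^ 2 / 4 * ((2 * h) ^ 2 - (2 * (ℓ : K)) ^ 2)),
      prod_Icc_even_factor, prod_range_succ, mul_pow, pow_succ, mul_mul_mul_comm, ih]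
    have h1 : ((-1 : K) ^ (m + 1)) ^ 2 = 1 := by rw [← pow_mul, mul_comm, pow_mul]; simp
    generalize ∏ ℓ ∈ Icc 1 m, ((ℓ : K) ^ 2 / 4 * ((2 * h) ^ 2 - (2 * (ℓ : K)) ^ 2)) ^
      (2 * (m + 1 - ℓ)) = A
    rw [mul_pow ((-1) ^ (m + 1) * _), mul_pow ((-1) ^ (m + 1)), h1]
    ring

theorem sum_product_even (h : K) (m : ℕ) :
    (∏ i ∈ range (m + 1),
        2 * (rising (1 / 2 + h) i * rising (1 / 2 - h) i * (i.factorial : K) ^ 2)) *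
      ∏ i ∈ range m, -2 * (rising (1 / 2 + h) (i + 1) * rising (1 / 2 - h) (i + 1) *
        (i.factorial : K) ^ 2) =
      (-1) ^ m * (2 ^ (2 * m + 1) / (m.factorial : K) ^ 2) * ∏ ℓ ∈ Icc 1 m,
        ((ℓ : K) ^ 2 / 4 * ((2 * h) ^ 2 - (2 * (ℓ : K) - 1) ^ 2)) ^ (2 * (m + 1 - ℓ)) := by
  induction m with
  | zero => simp [rising]
  | succ m ih =>
    rw [prod_Icc_pow_succ (fun ℓ => (ℓ : K) ^ 2 / 4 * ((2 * h) ^ 2 - (2 * (ℓ : K) - 1) ^ 2)),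
      prod_Icc_odd_factor, prod_range_succ _ (m + 1),
      prod_range_succ (fun i : ℕ => -2 * (rising (1 / 2 + h) (i + 1) * rising (1 / 2 - h) (i + 1) *
        (i.factorial : K) ^ 2)), mul_mul_mul_comm, ih]
    have h1 : ((-1 : K) ^ (m + 1)) ^ 2 = 1 := by rw [← pow_mul, mul_comm, pow_mul]; simp
    have hf : (m.factorial : K) ≠ 0 := by exact_mod_cast m.factorial_ne_zero
    have hm : (m + 1 : K) ≠ 0 := by exact_mod_cast m.succ_ne_zero
    generalize ∏ ℓ ∈ Icc 1 m, ((ℓ : K) ^ 2 / 4 * ((2 * h) ^ 2 - (2 * (ℓ : K) - 1) ^ 2)) ^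
      (2 * (m + 1 - ℓ)) = A
    rw [mul_pow ((-1) ^ (m + 1) * _), mul_pow ((-1) ^ (m + 1)), h1, Nat.factorial_succ]
    push_cast
    field_simp
    ring

theorem sum_product_odd (h : K) (m : ℕ) :
    (∏ i ∈ range (m + 1),
        2 * (rising (1 / 2 + h) i * rising (1 / 2 - h) i * (i.factorial : K) ^ 2)) *
      ∏ i ∈ range (m + 1), -2 * (rising (1 / 2 + h) (i + 1) * rising (1 / 2 - h) (i + 1) *
        (i.factorial : K) ^ 2) =
      ∏ ℓ ∈ Icc 0 m, (ℓ.factorial : K) ^ 4 / 16 ^ ℓ *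
        ((2 * h) ^ 2 - (2 * (ℓ : K) + 1) ^ 2) ^ (2 * (m - ℓ) + 1) := by
  induction m with
  | zero => simp [rising]; ring
  | succ m ih =>
    have hsplit : ∏ ℓ ∈ Icc 0 m, (ℓ.factorial : K) ^ 4 / 16 ^ ℓ *
        ((2 * h) ^ 2 - (2 * (ℓ : K) + 1) ^ 2) ^ (2 * (m + 1 - ℓ) + 1) =
        (∏ ℓ ∈ Icc 0 m, (ℓ.factorial : K) ^ 4 / 16 ^ ℓ *
          ((2 * h) ^ 2 - (2 * (ℓ : K) + 1) ^ 2) ^ (2 * (m - ℓ) + 1)) *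
        (∏ ℓ ∈ range (m + 1), ((2 * h) ^ 2 - (2 * (ℓ : K) + 1) ^ 2)) ^ 2 := by
      rw [← prod_pow, Nat.range_succ_eq_Icc_zero, ← prod_mul_distrib]
      refine prod_congr rfl fun ℓ hl => ?_
      rw [mul_assoc, ← pow_add]
      congr 2
      have := (mem_Icc.1 hl).2
      omega
    rw [prod_Icc_succ_top (by omega), hsplit, ← ih, prod_range_odd_factor,
      prod_range_succ _ (m + 1), prod_range_succ _ (m + 1), rising_succ _ (m + 1),
      rising_succ _ (m + 1)]
    have h4 : ((-4 : K) ^ (m + 1)) ^ 2 = 16 ^ (m + 1) := by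
      rw [← pow_mul, mul_comm, pow_mul]; norm_num
    rw [mul_pow _ _ 2, h4, Nat.sub_self, mul_zero, zero_add, pow_one]
    have h16 : (16 : K) ^ (m + 1) ≠ 0 := pow_ne_zero _ (by norm_num)
    generalize (∏ i ∈ range (m + 1), 2 * (_ : K)) = A
    field_simp
    push_cast
    ring

end Products

theorem theorem4p3 {K : Type*} [Field K] [CharZero K] (q r s : ℤ) (hq : 1 ≤ q) (hr : 0 ≤ r)
    (hrs : r < s) (x : K) (m : ℕ) :
    hankelDet (2 * m) (eulerDiff q r s x) = 0 ∧
    hankelDet (2 * m + 1) (eulerDiff q r s x) =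
      (-1) ^ (m + 1) * (((s : K) - (r : K)) / (q : K)) ^ (2 * m + 2) *
        ∏ ℓ ∈ Finset.Icc 1 m,
          ((ℓ : K) ^ 2 / 4 * ((((s : K) - (r : K)) / (q : K)) ^ 2 - (2 * (ℓ : K)) ^ 2)) ^
            (2 * (m + 1 - ℓ)) ∧
    hankelDet (2 * m) (eulerSum q r s x) =
      (-1) ^ m * (2 ^ (2 * m + 1) / (Nat.factorial m : K) ^ 2) *
        ∏ ℓ ∈ Finset.Icc 1 m,
          ((ℓ : K) ^ 2 / 4 * ((((s : K) - (r : K)) / (q : K)) ^ 2 - (2 * (ℓ : K) - 1) ^ 2)) ^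
            (2 * (m + 1 - ℓ)) ∧
    hankelDet (2 * m + 1) (eulerSum q r s x) =
      ∏ ℓ ∈ Finset.Icc 0 m,
        (Nat.factorial ℓ : K) ^ 4 / 16 ^ ℓ *
          ((((s : K) - (r : K)) / (q : K)) ^ 2 - (2 * (ℓ : K) + 1) ^ 2) ^ (2 * (m - ℓ) + 1) := by
  set y : K := (x + r) / q with hy
  set y' : K := (x + s) / q with hy'
  set h : K := (y' - y) / 2 with hh
  have hd : ((s : K) - r) / q = 2 * h := by
    rw [hh, hy, hy']; ring
  have hdiff : eulerDiff q r s x = fun k => eulerValue k y + (-1) * eulerValue k y' := by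
    funext k
    rw [eulerDiff, neg_one_mul, sub_eq_add_neg]
  have hsum : eulerSum q r s x = fun k => eulerValue k y + 1 * eulerValue k y' := by
    funext k
    rw [eulerSum, one_mul]
  have hLd := centeredFunctional_average (-1) y y'
  have hLs := centeredFunctional_average 1 y y'
  rw [hd, hdiff, hsum]
  simp only [hankelDet_eq_det_centeredFunctional]
  refine ⟨?_, ?_, ?_, ?_⟩
  · exact det_hankelMatrix_odd_size_eq_zero _ (functional_X_pow_even_eq_zero hLd) m
  · rw [← difference_product, ← det_odd_moments hLd,
      show 2 * m + 1 + 1 = (m + 1) + (m + 1) by ring]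
    exact det_hankelMatrix_of_even_eq_zero (fun k => centeredFunctional (-1) y y' (X ^ k))
      (functional_X_pow_even_eq_zero hLd) (m + 1)
  · rw [← sum_product_even, ← det_even_moments hLs, ← det_even_moments_shift hLs,
      show 2 * m + 1 = (m + 1) + m by ring]
    exact det_hankelMatrix_of_odd_eq_zero (fun k => centeredFunctional 1 y y' (X ^ k))
      (functional_X_pow_odd_eq_zero hLs) (m + 1) m m.le_succ le_rfl
  · rw [← sum_product_odd, ← det_even_moments hLs, ← det_even_moments_shift hLs,
      show 2 * m + 1 + 1 = (m + 1) + (m + 1) by ring]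
    exact det_hankelMatrix_of_odd_eq_zero (fun k => centeredFunctional 1 y y' (X ^ k))
      (functional_X_pow_odd_eq_zero hLs) (m + 1) (m + 1) le_rfl (Nat.le_succ _)
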